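/- **Setting.** A bidder takes part in repeated first-price auctions $t=1,2,\dots$. In auction $t$ she submits a bid $B_t\in[0,1]$; the highest competing bid is $M_t\in[0,1]$ and the item has value $V_t$. If $M_t\le B_t$ she wins, pays $B_t$ and observes $V_t$; otherwise $V_t$ is not observed. The $M_t$ are i.i.d. with CDF $F$, the $V_t$ are i.i.d. Bernoulli with expectation $v\in[0,1]$, and the two sequences are independent. The distribution $F$ is known to the bidder: a strategy chooses $B_t$ as a measurable function of $F$, of a private randomization independent of the auctions, and of the past observations $(M_s, V_s\mathbf 1\{M_s\le B_s\})_{s<t}$. Put $U_{v,F}(b)=(v-b)F(b)$, let $b^*_{v,F}$ be the largest maximizer of $U_{v,F}$ on $[0,1]$, and let $$R_T^{v,F}=T\max_{b\in[0,1]}U_{v,F}(b)-\sum_{t=1}^T\mathbb E\big[U_{v,F}(B_t)\big].$$ **Environments.** Fix $\lambda\in\mathbb R$, $c_f>0$ and $C_f\in\mathbb{R}$. Consider all environments $(v,F)$ with Bernoulli values as above such that $F(b^*_{v,F})>0$; $F$ is a continuous CDF of a law on $[0,1]$, is continuously differentiable on $[0,1]$ (one-sided at the end points) with $f=F'$, and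 is strictly log-concave (i.e. $\log F$ is strictly concave on $\{b\in[0,1]: F(b)>0\}$); $c_f<f(b)<C_f$ for all $b\in[0,1]$; and $\phi_F(b)=b+F(b)/f(b)$ is differentiable on $[0,1]$ with $\phi_F'\le\lambda$. **Theorem.** Suppose that a strategy is such that 1. for every such environment $(v,F)$ and every $a>0$, $R_T^{v,F}=O(T^a)$ as $T\to\infty$; 2. for every such $F$ there is $\gamma>0$ such that, for every $v$ for which $(v,F)$ is such an environment and for every $t\ge1$, $\mathbb P_{v,F}(B_t<b^*_{v,F})<t^{-\gamma}$. Then, for every such environment $(v,F)$, $$\liminf_{T\to\infty}\frac{R_T^{v,F}}{\log T}\ \ge\ c_f^2\lambda^2\,\frac{v(1-v)(v-b^*_{v,F})}{32},$$ the lower limit being taken in $[-\infty,+\infty]$. -/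

import Mathlib

open MeasureTheory ProbabilityTheory Filter Set
open scoped unitInterval

namespace FirstPrice

noncomputable section

/-- First-price utility `U_{v,F}(b) = (v - b) F(b)` of the bid `b`. -/
def utility (v : ℝ) (F : ℝ → ℝ) (b : ℝ) : ℝ := (v - b) * F b

/-- `b*_{v,F}`: the largest maximizer of the utility over `[0,1]`. -/
def bestBid (v : ℝ) (F : ℝ → ℝ) : ℝ :=
  sSup {b | b ∈ Icc (0 : ℝ) 1 ∧ IsMaxOn (utility v F) (Icc 0 1) b}

/-- The density `f = F'` on `[0,1]` (one-sided derivative at the end points). -/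
def density (F : ℝ → ℝ) (b : ℝ) : ℝ := derivWithin F (Icc 0 1) b

/-- `φ_F(b) = b + F(b) / f(b)`. -/
def phi (F : ℝ → ℝ) (b : ℝ) : ℝ := b + F b / density F b

/-- Laws on `[0,1]` of the highest competing bid whose CDF `F` is continuously differentiable and
strictly log-concave, with `c_f < f < C_f` and `φ_F' ≤ lam` on `[0,1]`.
Continuity of `F` on the whole line excludes atoms at the end points, so that `f` is a genuine
density of the law. -/
structure IsRegularBidLaw (lam cf Cf : ℝ) (μ : ProbabilityMeasure ℝ) : Prop where
  supported : (μ : Measure ℝ) (Icc 0 1) = 1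
  continuous_cdf : Continuous (cdf (μ : Measure ℝ))
  contDiffOn_cdf : ContDiffOn ℝ 1 (cdf (μ : Measure ℝ)) (Icc 0 1)
  strictLogConcave : StrictConcaveOn ℝ {b | b ∈ Icc (0 : ℝ) 1 ∧ 0 < cdf (μ : Measure ℝ) b}
    (fun b => Real.log (cdf (μ : Measure ℝ) b))
  density_bounds : ∀ b ∈ Icc (0 : ℝ) 1,
    cf < density (cdf (μ : Measure ℝ)) b ∧ density (cdf (μ : Measure ℝ)) b < Cf
  differentiableOn_phi : DifferentiableOn ℝ (phi (cdf (μ : Measure ℝ))) (Icc 0 1)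
  deriv_phi_le : ∀ b ∈ Icc (0 : ℝ) 1,
    derivWithin (phi (cdf (μ : Measure ℝ))) (Icc 0 1) b ≤ lam

/-- A (randomized) bidding strategy. `bid t s h` is the bid submitted in the auction number
`t + 1`, where `s` is the private randomization and `h` lists the observations made in the first
`t` auctions; the observation of an auction is `(M, V')`, with `M` the highest competing bid and
`V'` the value if the auction was won, `0` otherwise. The earlier bids (hence which auctions were
won) are themselves functions of `s` and `h`. -/
structure Strategy (S : Type*) [MeasurableSpace S] where
  bid : (t : ℕ) → S → (Fin t → ℝ × ℝ) → ℝ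
  measurable_bid : ∀ t, Measurable (fun p : S × (Fin t → ℝ × ℝ) => bid t p.1 p.2)
  bid_mem : ∀ t s h, bid t s h ∈ Icc (0 : ℝ) 1

variable {S : Type*} [MeasurableSpace S]

/-- What the bidder observes after bidding `b` when the highest competing bid is `x.1` and the
value is `x.2`: ties are won, and the value is seen only on winning. -/
def observe (b : ℝ) (x : ℝ × ℝ) : ℝ × ℝ := (x.1, if x.1 ≤ b then x.2 else 0)

/-- The first `t` observations of the bidder, when `x i = (M_{i+1}, V_{i+1})`. -/
def Strategy.history (π : Strategy S) (s : S) (x : ℕ → ℝ × ℝ) : (t : ℕ) → (Fin t → ℝ × ℝ)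
  | 0 => Fin.elim0
  | t + 1 => Fin.snoc (α := fun _ => ℝ × ℝ) (π.history s x t)
      (observe (π.bid t s (π.history s x t)) (x t))

/-- The random bid `B_{t+1}` as a function of the outcome `(s, x)`. -/
def Strategy.bidAt (π : Strategy S) (t : ℕ) (ω : S × (ℕ → ℝ × ℝ)) : ℝ :=
  π.bid t ω.1 (π.history ω.1 ω.2 t)

/-- The joint law of the randomization (law `ν`) and of the sequence `(M_t, V_t)`: everything is
independent, `M_t` has law `μ` and `V_t` is Bernoulli with expectation `v`. -/
def outcomeLaw (ν : Measure S) (v : I) (μ : ProbabilityMeasure ℝ) :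
    Measure (S × (ℕ → ℝ × ℝ)) :=
  ν.prod (Measure.infinitePi fun _ : ℕ =>
    (μ : Measure ℝ).prod (bernoulliMeasure (1 : ℝ) 0 v))

/-- The pseudo-regret `R_T^{v,F}`. -/
def regret (ν : Measure S) (π : Strategy S) (v : I) (μ : ProbabilityMeasure ℝ) (T : ℕ) : ℝ :=
  T * sSup (utility v (cdf (μ : Measure ℝ)) '' Icc 0 1)
    - ∑ t ∈ Finset.range T,
        ∫ ω, utility v (cdf (μ : Measure ℝ)) (π.bidAt t ω) ∂(outcomeLaw ν v μ)

end

end FirstPrice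

namespace FirstPrice

/-! ### Analysis of the utility: best bid, first-order condition, curvature. -/

section Analysis

variable {lam cf Cf : ℝ} {μ : ProbabilityMeasure ℝ}

/-! For `0 < v < 1` the ratio `R_T / log T` exceeds every constant, because the bound on
underbidding holds for all values at once. Before auction `t + 1`, compare `v` with `w = v + δ`,
where `δ ^ 2 = c / (t + 1)`. The second moment of the likelihood ratio over `t` auctions is at most
a constant `exp D`, so by Cauchy–Schwarz (`outcomeLaw_real_bidAt_sq_le`) the probability under `v`
of bidding below `b*_w` has square at most `exp D * (t + 1) ^ (-γ)`, which tends to `0`. Eventually,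
then, with probability above one half the bid under `v` is at least `b*_w`.

Since `φ_F' ≤ lam` and `φ_F(b*_v) = v`, this bid exceeds `b*_v` by at least `δ / lam`; since `φ_F`
is expansive and `f > cf`, the loss is at least `(cf / 2) * (δ / lam) ^ 2`. The constant `c` is
free, so the regret of an auction eventually exceeds `K / (t + 1)` for any `K`
(`eventually_div_le_round_regret`), and summation gives `K log T`. For `v = 0` or `v = 1` the
claimed bound is zero. -/

theorem IsRegularBidLaw.cdf_zero (hμ : IsRegularBidLaw lam cf Cf μ) :
    cdf (μ : Measure ℝ) 0 = 0 := by
  have hneg : ∀ x ∈ Iio (0 : ℝ), cdf (μ : Measure ℝ) x = 0 := by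
    intro x hx
    have hcompl : (μ : Measure ℝ) (Icc 0 1)ᶜ = 0 :=
      (prob_compl_eq_zero_iff measurableSet_Icc).2 hμ.supported
    have hzero : (μ : Measure ℝ) (Iic x) = 0 :=
      measure_mono_null (t := (Icc 0 1)ᶜ)
        (fun y hy h => not_le.2 (lt_of_le_of_lt (mem_Iic.1 hy) hx) h.1) hcompl
    rw [cdf_eq_real, measureReal_def, hzero, ENNReal.toReal_zero]
  have hclosed : IsClosed {x | cdf (μ : Measure ℝ) x = 0} :=
    isClosed_eq hμ.continuous_cdf continuous_const
  have hsub : closure (Iio (0 : ℝ)) ⊆ {x | cdf (μ : Measure ℝ) x = 0} :=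
    closure_minimal hneg hclosed
  rw [closure_Iio] at hsub
  exact hsub self_mem_Iic

theorem IsRegularBidLaw.hasDerivAt_cdf (hμ : IsRegularBidLaw lam cf Cf μ) {b : ℝ}
    (hb : b ∈ Ioo (0 : ℝ) 1) :
    HasDerivAt (cdf (μ : Measure ℝ)) (density (cdf (μ : Measure ℝ)) b) b :=
  ((hμ.contDiffOn_cdf.differentiableOn one_ne_zero) b
    (Ioo_subset_Icc_self hb)).hasDerivWithinAt.hasDerivAt (Icc_mem_nhds hb.1 hb.2)

theorem IsRegularBidLaw.density_pos (hμ : IsRegularBidLaw lam cf Cf μ) (hcf : 0 < cf) {b : ℝ}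
    (hb : b ∈ Icc (0 : ℝ) 1) : 0 < density (cdf (μ : Measure ℝ)) b :=
  hcf.trans (hμ.density_bounds b hb).1

theorem IsRegularBidLaw.cdf_pos (hμ : IsRegularBidLaw lam cf Cf μ) (hcf : 0 < cf) {b : ℝ}
    (hb : b ∈ Ioc (0 : ℝ) 1) : 0 < cdf (μ : Measure ℝ) b := by
  have hmono : StrictMonoOn (cdf (μ : Measure ℝ)) (Icc 0 1) := by
    refine strictMonoOn_of_deriv_pos (convex_Icc 0 1) hμ.continuous_cdf.continuousOn ?_
    intro x hx
    rw [interior_Icc] at hx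
    rw [(hμ.hasDerivAt_cdf hx).deriv]
    exact hμ.density_pos hcf (Ioo_subset_Icc_self hx)
  have h := hmono ⟨le_rfl, zero_le_one⟩ ⟨hb.1.le, hb.2⟩ hb.1
  rwa [hμ.cdf_zero] at h

/-- By log-concavity, `F / f` is nondecreasing. -/
theorem IsRegularBidLaw.monotoneOn_cdf_div_density (hμ : IsRegularBidLaw lam cf Cf μ)
    (hcf : 0 < cf) :
    MonotoneOn (fun b => cdf (μ : Measure ℝ) b / density (cdf (μ : Measure ℝ)) b) (Ioo 0 1) := by
  have hpos : ∀ x ∈ Ioo (0 : ℝ) 1, 0 < cdf (μ : Measure ℝ) x := fun x hx =>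
    hμ.cdf_pos hcf (Ioo_subset_Ioc_self hx)
  have hderiv : ∀ x ∈ Ioo (0 : ℝ) 1,
      HasDerivAt (fun b => Real.log (cdf (μ : Measure ℝ) b))
        (density (cdf (μ : Measure ℝ)) x / cdf (μ : Measure ℝ) x) x := fun x hx =>
    (hμ.hasDerivAt_cdf hx).log (hpos x hx).ne'
  have hconc : ConcaveOn ℝ (Ioo (0 : ℝ) 1) (fun b => Real.log (cdf (μ : Measure ℝ) b)) :=
    hμ.strictLogConcave.concaveOn.subset
      (fun x hx => ⟨Ioo_subset_Icc_self hx, hpos x hx⟩) (convex_Ioo 0 1)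
  have hanti := hconc.antitoneOn_deriv fun x hx => (hderiv x hx).differentiableAt
  intro x hx y hy hxy
  have h := hanti hx hy hxy
  rw [(hderiv x hx).deriv, (hderiv y hy).deriv] at h
  have hfy := hμ.density_pos hcf (Ioo_subset_Icc_self hy)
  have hfx := hμ.density_pos hcf (Ioo_subset_Icc_self hx)
  rw [div_le_div_iff₀ (hpos y hy) (hpos x hx)] at h
  change _ / _ ≤ _ / _
  rw [div_le_div_iff₀ hfx hfy]
  linarith

/-- `φ_F` is the identity plus the nondecreasing `F / f`, hence expansive. -/
theorem IsRegularBidLaw.sub_le_phi_sub_phi (hμ : IsRegularBidLaw lam cf Cf μ) (hcf : 0 < cf)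
    {x y : ℝ} (hx : x ∈ Ioo (0 : ℝ) 1) (hy : y ∈ Ioo (0 : ℝ) 1) (hxy : x ≤ y) :
    y - x ≤ phi (cdf (μ : Measure ℝ)) y - phi (cdf (μ : Measure ℝ)) x := by
  have h := hμ.monotoneOn_cdf_div_density hcf hx hy hxy
  simp only [phi] at h ⊢
  linarith

theorem IsRegularBidLaw.phi_sub_phi_le (hμ : IsRegularBidLaw lam cf Cf μ)
    {x y : ℝ} (hx : x ∈ Icc (0 : ℝ) 1) (hy : y ∈ Icc (0 : ℝ) 1) (hxy : x ≤ y) :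
    phi (cdf (μ : Measure ℝ)) y - phi (cdf (μ : Measure ℝ)) x ≤ lam * (y - x) := by
  refine (convex_Icc (0 : ℝ) 1).image_sub_le_mul_sub_of_deriv_le
    hμ.differentiableOn_phi.continuousOn (hμ.differentiableOn_phi.mono interior_subset)
    ?_ x hx y hy hxy
  intro z hz
  rw [interior_Icc] at hz
  rw [← derivWithin_of_mem_nhds (Icc_mem_nhds hz.1 hz.2)]
  exact hμ.deriv_phi_le z (Ioo_subset_Icc_self hz)

/-- `φ_F` climbs from `φ_F(0) = 0` to `φ_F(1) > 1`, which bounds its slope from below. -/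
theorem IsRegularBidLaw.lam_pos (hμ : IsRegularBidLaw lam cf Cf μ) (hcf : 0 < cf) : 0 < lam := by
  have h := hμ.phi_sub_phi_le (left_mem_Icc.2 zero_le_one) (right_mem_Icc.2 zero_le_one)
    zero_le_one
  have hdiv : 0 < cdf (μ : Measure ℝ) 1 / density (cdf (μ : Measure ℝ)) 1 :=
    div_pos (hμ.cdf_pos hcf ⟨one_pos, le_rfl⟩)
      (hμ.density_pos hcf (right_mem_Icc.2 zero_le_one))
  simp only [phi, hμ.cdf_zero, zero_div] at h
  linarith

theorem IsRegularBidLaw.continuous_utility (hμ : IsRegularBidLaw lam cf Cf μ) (v : ℝ) :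
    Continuous (utility v (cdf (μ : Measure ℝ))) :=
  (continuous_const.sub continuous_id).mul hμ.continuous_cdf

theorem IsRegularBidLaw.bestBid_mem (hμ : IsRegularBidLaw lam cf Cf μ) (v : ℝ) :
    bestBid v (cdf (μ : Measure ℝ)) ∈ Icc (0 : ℝ) 1 ∧
      IsMaxOn (utility v (cdf (μ : Measure ℝ))) (Icc 0 1) (bestBid v (cdf (μ : Measure ℝ))) := by
  have hU := hμ.continuous_utility v
  obtain ⟨b, hb, hmax⟩ := isCompact_Icc.exists_isMaxOn (nonempty_Icc.2 (zero_le_one (α := ℝ)))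
    hU.continuousOn
  -- The maximizers form a compact set, so the supremum defining the best bid is attained.
  have hset : {b | b ∈ Icc (0 : ℝ) 1 ∧ IsMaxOn (utility v (cdf (μ : Measure ℝ))) (Icc 0 1) b} =
      Icc 0 1 ∩ {x | utility v (cdf (μ : Measure ℝ)) b ≤ utility v (cdf (μ : Measure ℝ)) x} := by
    ext x
    exact ⟨fun h => ⟨h.1, h.2 hb⟩, fun h => ⟨h.1, isMaxOn_iff.2 fun y hy => le_trans (hmax hy) h.2⟩⟩
  have hcomp : IsCompact
      {b | b ∈ Icc (0 : ℝ) 1 ∧ IsMaxOn (utility v (cdf (μ : Measure ℝ))) (Icc 0 1) b} := by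
    rw [hset]
    exact isCompact_Icc.inter_right (isClosed_le continuous_const hU)
  exact hcomp.sSup_mem ⟨b, hb, hmax⟩

/-- The bid `v / 2` has positive utility, whereas the utility is zero at `0` and nonpositive from
`v` on. -/
theorem IsRegularBidLaw.bestBid_mem_Ioo (hμ : IsRegularBidLaw lam cf Cf μ) (hcf : 0 < cf) {v : ℝ}
    (hv : v ∈ Ioo (0 : ℝ) 1) : bestBid v (cdf (μ : Measure ℝ)) ∈ Ioo 0 v := by
  obtain ⟨⟨h0, h1⟩, hmax⟩ := hμ.bestBid_mem v
  set b := bestBid v (cdf (μ : Measure ℝ))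
  have hhalf : 0 < utility v (cdf (μ : Measure ℝ)) (v / 2) :=
    mul_pos (by linarith [hv.1]) (hμ.cdf_pos hcf ⟨by linarith [hv.1], by linarith [hv.1, hv.2]⟩)
  have hpos : 0 < (v - b) * cdf (μ : Measure ℝ) b :=
    hhalf.trans_le (hmax (show v / 2 ∈ Icc (0 : ℝ) 1 from
      ⟨by linarith [hv.1], by linarith [hv.1, hv.2]⟩))
  refine ⟨h0.lt_of_ne fun h => ?_, ?_⟩
  · rw [← h, hμ.cdf_zero] at hpos
    simp at hpos
  · exact sub_pos.1 (pos_of_mul_pos_left hpos (cdf_nonneg _ _))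

/-- Factoring out `f` leaves the sign of the derivative to the comparison of `φ_F(b)` with `v`. -/
theorem IsRegularBidLaw.hasDerivAt_utility (hμ : IsRegularBidLaw lam cf Cf μ) (hcf : 0 < cf)
    (v : ℝ) {b : ℝ} (hb : b ∈ Ioo (0 : ℝ) 1) :
    HasDerivAt (utility v (cdf (μ : Measure ℝ)))
      (density (cdf (μ : Measure ℝ)) b * (v - phi (cdf (μ : Measure ℝ)) b)) b := by
  have hf := (hμ.density_pos hcf (Ioo_subset_Icc_self hb)).ne'
  have h := ((hasDerivAt_id b).const_sub v).mul (hμ.hasDerivAt_cdf hb)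
  refine h.congr_deriv ?_
  simp only [phi, id]
  field_simp
  ring

/-- First-order condition for the best bid. -/
theorem IsRegularBidLaw.phi_bestBid (hμ : IsRegularBidLaw lam cf Cf μ) (hcf : 0 < cf) {v : ℝ}
    (hv : v ∈ Ioo (0 : ℝ) 1) :
    phi (cdf (μ : Measure ℝ)) (bestBid v (cdf (μ : Measure ℝ))) = v := by
  obtain ⟨h0, hbv⟩ := hμ.bestBid_mem_Ioo hcf hv
  have hb : bestBid v (cdf (μ : Measure ℝ)) ∈ Ioo (0 : ℝ) 1 := ⟨h0, hbv.trans hv.2⟩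
  have hloc := (hμ.bestBid_mem v).2.isLocalMax (Icc_mem_nhds hb.1 hb.2)
  have h := hloc.hasDerivAt_eq_zero (hμ.hasDerivAt_utility hcf v hb)
  have hf := (hμ.density_pos hcf (Ioo_subset_Icc_self hb)).ne'
  linarith [(mul_eq_zero.1 h).resolve_left hf]

/-- Quadratic loss of utility above the best bid. -/
theorem IsRegularBidLaw.sq_le_utility_sub (hμ : IsRegularBidLaw lam cf Cf μ) (hcf : 0 < cf) {v : ℝ}
    (hv : v ∈ Ioo (0 : ℝ) 1) {b : ℝ} (hb : b ∈ Icc (bestBid v (cdf (μ : Measure ℝ))) 1) :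
    cf / 2 * (b - bestBid v (cdf (μ : Measure ℝ))) ^ 2 ≤
      utility v (cdf (μ : Measure ℝ)) (bestBid v (cdf (μ : Measure ℝ))) -
        utility v (cdf (μ : Measure ℝ)) b := by
  obtain ⟨h0, hbv⟩ := hμ.bestBid_mem_Ioo hcf hv
  have hfoc := hμ.phi_bestBid hcf hv
  set β := bestBid v (cdf (μ : Measure ℝ))
  have hβ : β ∈ Ioo (0 : ℝ) 1 := ⟨h0, hbv.trans hv.2⟩
  have hderiv : ∀ x ∈ Ioo β 1, HasDerivAt
      (fun x => utility v (cdf (μ : Measure ℝ)) x + cf / 2 * (x - β) ^ 2)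
      (density (cdf (μ : Measure ℝ)) x * (v - phi (cdf (μ : Measure ℝ)) x) + cf * (x - β)) x := by
    intro x hx
    have h := (((hasDerivAt_id x).sub_const β).pow 2).const_mul (cf / 2)
    refine ((hμ.hasDerivAt_utility hcf v ⟨h0.trans hx.1, hx.2⟩).add h).congr_deriv ?_
    simp
    ring
  -- The added parabola does not spoil monotonicity: to the right of `β`, `φ_F(x) - v ≥ x - β` and
  -- `f > cf`.
  have hanti : AntitoneOn
      (fun x => utility v (cdf (μ : Measure ℝ)) x + cf / 2 * (x - β) ^ 2) (Icc β 1) := by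
    refine antitoneOn_of_deriv_nonpos (convex_Icc β 1)
      ((hμ.continuous_utility v).add (by fun_prop)).continuousOn ?_ ?_
    · rw [interior_Icc]
      exact fun x hx => (hderiv x hx).differentiableAt.differentiableWithinAt
    · rw [interior_Icc]
      intro x hx
      have hx' : x ∈ Ioo (0 : ℝ) 1 := ⟨h0.trans hx.1, hx.2⟩
      rw [(hderiv x hx).deriv]
      have h1 := hμ.sub_le_phi_sub_phi hcf hβ hx' hx.1.le
      have h2 := (hμ.density_bounds x (Ioo_subset_Icc_self hx')).1
      rw [hfoc] at h1
      nlinarith [mul_le_mul h2.le h1 (sub_nonneg.2 hx.1.le) (hcf.trans h2).le]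
  have h := hanti (left_mem_Icc.2 (hb.1.trans hb.2)) hb hb.1
  simp only [sub_self] at h
  linarith

/-- The best bid grows at least at rate `1 / lam` with the value. -/
theorem IsRegularBidLaw.sub_le_lam_mul_bestBid_sub (hμ : IsRegularBidLaw lam cf Cf μ)
    (hcf : 0 < cf) {v w : ℝ} (hv : v ∈ Ioo (0 : ℝ) 1) (hw : w ∈ Ioo (0 : ℝ) 1) (hvw : v < w) :
    bestBid v (cdf (μ : Measure ℝ)) ≤ bestBid w (cdf (μ : Measure ℝ)) ∧
      w - v ≤ lam * (bestBid w (cdf (μ : Measure ℝ)) - bestBid v (cdf (μ : Measure ℝ))) := by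
  have hb := hμ.bestBid_mem_Ioo hcf hv
  have hc := hμ.bestBid_mem_Ioo hcf hw
  have hb' : bestBid v (cdf (μ : Measure ℝ)) ∈ Ioo (0 : ℝ) 1 := ⟨hb.1, hb.2.trans hv.2⟩
  have hc' : bestBid w (cdf (μ : Measure ℝ)) ∈ Ioo (0 : ℝ) 1 := ⟨hc.1, hc.2.trans hw.2⟩
  have hle : bestBid v (cdf (μ : Measure ℝ)) ≤ bestBid w (cdf (μ : Measure ℝ)) := by
    by_contra! hlt
    have h := hμ.sub_le_phi_sub_phi hcf hc' hb' hlt.le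
    rw [hμ.phi_bestBid hcf hv, hμ.phi_bestBid hcf hw] at h
    linarith
  have h := hμ.phi_sub_phi_le (Ioo_subset_Icc_self hb') (Ioo_subset_Icc_self hc') hle
  rw [hμ.phi_bestBid hcf hv, hμ.phi_bestBid hcf hw] at h
  exact ⟨hle, h⟩

end Analysis

/-! ### Change of measure through second moments. -/

section ChangeOfMeasure

open scoped ENNReal

variable {X Y : Type*} [MeasurableSpace X] [MeasurableSpace Y]

/-- The operator form of a bound by `C` on the second moment under `Q` of the likelihood ratio
`dP/dQ`. -/
def SecondMomentBound (P Q : Measure X) (C : ℝ≥0∞) : Prop :=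
  ∀ g : X → ℝ≥0∞, Measurable g → (∫⁻ x, g x ∂P) ^ 2 ≤ C * ∫⁻ x, g x ^ 2 ∂Q

theorem SecondMomentBound.refl (P : Measure X) [IsProbabilityMeasure P] :
    SecondMomentBound P P 1 := by
  intro g hg
  have h := ENNReal.lintegral_mul_le_Lp_mul_Lq P Real.HolderConjugate.two_two
    hg.aemeasurable (aemeasurable_const (b := (1 : ℝ≥0∞)))
  simp only [Pi.mul_apply, mul_one, lintegral_const, measure_univ,
    ENNReal.rpow_two, one_pow, ENNReal.one_rpow] at h
  calc (∫⁻ x, g x ∂P) ^ 2 ≤ ((∫⁻ x, g x ^ 2 ∂P) ^ (1 / 2 : ℝ)) ^ 2 := by gcongr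
    _ = 1 * ∫⁻ x, g x ^ 2 ∂P := by
      rw [← ENNReal.rpow_two, ← ENNReal.rpow_mul]
      norm_num

/-- The operator form tensorizes by bounding the outer integral, then the inner one; no density is
needed. -/
theorem SecondMomentBound.prod {P Q : Measure X} {P' Q' : Measure Y} [SFinite P'] [SFinite Q']
    {C C' : ℝ≥0∞} (h : SecondMomentBound P Q C) (h' : SecondMomentBound P' Q' C') :
    SecondMomentBound (P.prod P') (Q.prod Q') (C * C') := by
  intro g hg
  rw [lintegral_prod _ hg.aemeasurable, lintegral_prod _ (hg.pow_const 2).aemeasurable]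
  calc (∫⁻ x, ∫⁻ y, g (x, y) ∂P' ∂P) ^ 2
      ≤ C * ∫⁻ x, (∫⁻ y, g (x, y) ∂P') ^ 2 ∂Q := h _ hg.lintegral_prod_right'
    _ ≤ C * ∫⁻ x, C' * ∫⁻ y, g (x, y) ^ 2 ∂Q' ∂Q := by
      gcongr with x
      exact h' _ (hg.comp measurable_prodMk_left)
    _ = C * C' * ∫⁻ x, ∫⁻ y, g (x, y) ^ 2 ∂Q' ∂Q := by
      rw [lintegral_const_mul _ (hg.pow_const 2).lintegral_prod_right', mul_assoc]

theorem SecondMomentBound.map {P Q : Measure X} {C : ℝ≥0∞} (h : SecondMomentBound P Q C)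
    {f : X → Y} (hf : Measurable f) : SecondMomentBound (P.map f) (Q.map f) C := by
  intro g hg
  rw [lintegral_map hg hf, lintegral_map (hg.pow_const 2) hf]
  exact h _ (hg.comp hf)

theorem SecondMomentBound.pi {P Q : Measure X} [IsProbabilityMeasure P] [IsProbabilityMeasure Q]
    {C : ℝ≥0∞} (h : SecondMomentBound P Q C) (n : ℕ) :
    SecondMomentBound (Measure.pi fun _ : Fin n => P) (Measure.pi fun _ : Fin n => Q) (C ^ n) := by
  induction n with
  | zero =>
    rw [pow_zero, Measure.pi_of_empty, Measure.pi_of_empty]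
    exact SecondMomentBound.refl _
  | succ n ih =>
    have hP := (measurePreserving_piFinSuccAbove (fun _ : Fin (n + 1) => P) 0).symm
    have hQ := (measurePreserving_piFinSuccAbove (fun _ : Fin (n + 1) => Q) 0).symm
    have hmap := (h.prod ih).map
      (MeasurableEquiv.piFinSuccAbove (fun _ : Fin (n + 1) => X) 0).symm.measurable
    rw [hP.map_eq, hQ.map_eq] at hmap
    rwa [pow_succ']

theorem SecondMomentBound.measure_sq_le {P Q : Measure X} {C : ℝ≥0∞}
    (h : SecondMomentBound P Q C) {A : Set X} (hA : MeasurableSet A) :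
    P A ^ 2 ≤ C * Q A := by
  have hg := h (A.indicator 1) (measurable_one.indicator hA)
  have hsq : (fun x => A.indicator (1 : X → ℝ≥0∞) x ^ 2) = A.indicator 1 := by
    ext x
    by_cases hx : x ∈ A <;> simp [hx]
  rwa [hsq, lintegral_indicator_one hA, lintegral_indicator_one hA] at hg

/-- The constant is one plus the chi-square divergence of two Bernoulli laws; the defect in
Cauchy–Schwarz is an explicit square. -/
theorem sq_add_le_secondMoment {v w : ℝ} (hw : w ∈ Ioo (0 : ℝ) 1) (x y : ℝ) :
    (v * x + (1 - v) * y) ^ 2 ≤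
      (1 + (v - w) ^ 2 / (w * (1 - w))) * (w * x ^ 2 + (1 - w) * y ^ 2) := by
  have hw0 := hw.1
  have hw1 : 0 < 1 - w := sub_pos.2 hw.2
  have heq : (1 + (v - w) ^ 2 / (w * (1 - w))) * (w * x ^ 2 + (1 - w) * y ^ 2) -
      (v * x + (1 - v) * y) ^ 2 = (v * (1 - w) * y - (1 - v) * w * x) ^ 2 / (w * (1 - w)) := by
    field_simp
    ring
  have hnonneg : 0 ≤ (v * (1 - w) * y - (1 - v) * w * x) ^ 2 / (w * (1 - w)) := by positivity
  linarith

theorem secondMomentBound_bernoulli (v w : I) (hw : (w : ℝ) ∈ Ioo (0 : ℝ) 1) :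
    SecondMomentBound (bernoulliMeasure (1 : ℝ) 0 v) (bernoulliMeasure (1 : ℝ) 0 w)
      (ENNReal.ofReal (1 + ((v : ℝ) - w) ^ 2 / (w * (1 - w)))) := by
  intro g hg
  have hw0 := hw.1
  have hw1 : 0 < 1 - (w : ℝ) := sub_pos.2 hw.2
  have hC : 0 < 1 + ((v : ℝ) - w) ^ 2 / (w * (1 - w)) := by positivity
  have hint : ∀ (u : I) (k : ℝ → ℝ≥0∞), ∫⁻ x, k x ∂(bernoulliMeasure (1 : ℝ) 0 u) =
      ENNReal.ofReal u * k 1 + ENNReal.ofReal (1 - u) * k 0 := by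
    intro u k
    rw [bernoulliMeasure_def, lintegral_add_measure, lintegral_smul_measure,
      lintegral_smul_measure, lintegral_dirac, lintegral_dirac]
    congr 1
    · simp only [ENNReal.smul_def, smul_eq_mul]
      congr 1
      rw [ENNReal.ofReal, ENNReal.coe_inj]
      ext
      simp [u.2.1]
    · simp only [ENNReal.smul_def, smul_eq_mul]
      congr 1
      rw [ENNReal.ofReal, ENNReal.coe_inj]
      ext
      simp [u.2.2]
  rw [hint, hint]
  have hCne : ENNReal.ofReal (1 + ((v : ℝ) - w) ^ 2 / (w * (1 - w))) ≠ 0 := by simpa using hC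
  -- Both atoms have positive mass under `w`, so an infinite value of `g` makes the right-hand side
  -- infinite.
  by_cases h1 : g 1 = ⊤
  · have : ENNReal.ofReal (w : ℝ) ≠ 0 := by simpa using hw0
    simp [h1, ENNReal.mul_top, this, hCne]
  by_cases h0 : g 0 = ⊤
  · have : ENNReal.ofReal (1 - (w : ℝ)) ≠ 0 := by simpa using hw1
    rw [h0]
    simp [ENNReal.mul_top, this, hCne]
  have hv0 : (0 : ℝ) ≤ v := v.2.1
  have hv1 : (0 : ℝ) ≤ 1 - v := sub_nonneg.2 v.2.2
  rw [← ENNReal.ofReal_toReal h1, ← ENNReal.ofReal_toReal h0]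
  have hx : 0 ≤ (g 1).toReal := ENNReal.toReal_nonneg
  have hy : 0 ≤ (g 0).toReal := ENNReal.toReal_nonneg
  rw [← ENNReal.ofReal_pow hx, ← ENNReal.ofReal_pow hy, ← ENNReal.ofReal_mul hv0,
    ← ENNReal.ofReal_mul hv1, ← ENNReal.ofReal_mul hw0.le, ← ENNReal.ofReal_mul hw1.le,
    ← ENNReal.ofReal_add (by positivity) (by positivity),
    ← ENNReal.ofReal_add (by positivity) (by positivity), ← ENNReal.ofReal_pow (by positivity),
    ← ENNReal.ofReal_mul hC.le]
  exact ENNReal.ofReal_le_ofReal (sq_add_le_secondMoment hw _ _)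

theorem infinitePi_map_fin (P : Measure X) [IsProbabilityMeasure P] (n : ℕ) :
    (Measure.infinitePi fun _ : ℕ => P).map (fun x (i : Fin n) => x i) =
      Measure.pi fun _ : Fin n => P := by
  refine (Measure.pi_eq fun s hs => ?_).symm
  let t : ℕ → Set X := fun k => if h : k < n then s ⟨k, h⟩ else univ
  have ht : ∀ k ∈ Finset.range n, MeasurableSet (t k) := by
    intro k hk
    simpa [t, Finset.mem_range.1 hk] using hs ⟨k, Finset.mem_range.1 hk⟩
  have hpre : (fun (x : ℕ → X) (i : Fin n) => x i) ⁻¹' (univ.pi s) =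
      Set.pi (Finset.range n : Set ℕ) t := by
    ext x
    simp only [mem_preimage, Set.mem_pi, Finset.coe_range, mem_Iio, t]
    exact ⟨fun h k hk => by simpa [hk] using h ⟨k, hk⟩,
      fun h i => by simpa [i.2] using h i i.2⟩
  rw [Measure.map_apply (by fun_prop) (.univ_pi hs), hpre, Measure.infinitePi_pi _ ht,
    Finset.prod_range]
  simp [t]

end ChangeOfMeasure

/-! ### Bids as functions of finitely many auctions. -/

section History

variable {S : Type*} [MeasurableSpace S]

/-- The first `t` observations are a measurable function of the randomization and of the first `t`
auctions. -/
theorem Strategy.exists_measurable_history (π : Strategy S) (t : ℕ) :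
    ∃ H : S × (Fin t → ℝ × ℝ) → (Fin t → ℝ × ℝ), Measurable H ∧
      ∀ s x, π.history s x t = H (s, fun i => x i) := by
  induction t with
  | zero => exact ⟨fun p => p.2, measurable_snd, fun s x => Subsingleton.elim _ _⟩
  | succ t ih =>
    obtain ⟨H, hH, hist⟩ := ih
    let H' : S × (Fin (t + 1) → ℝ × ℝ) → (Fin t → ℝ × ℝ) :=
      fun p => H (p.1, fun i => p.2 i.castSucc)
    have hH' : Measurable H' := hH.comp (by fun_prop)
    have hbid : Measurable fun p : S × (Fin (t + 1) → ℝ × ℝ) => π.bid t p.1 (H' p) :=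
      (π.measurable_bid t).comp (measurable_fst.prodMk hH')
    have hlast : Measurable fun p : S × (Fin (t + 1) → ℝ × ℝ) => p.2 (Fin.last t) := by fun_prop
    refine ⟨fun p => Fin.snoc (α := fun _ => ℝ × ℝ) (H' p)
      (observe (π.bid t p.1 (H' p)) (p.2 (Fin.last t))), ?_, fun s x => ?_⟩
    · refine measurable_pi_iff.2 fun i => ?_
      refine Fin.lastCases ?_ (fun j => ?_) i
      · simp only [Fin.snoc_last, observe]
        exact hlast.fst.prodMk
          (Measurable.ite (measurableSet_le hlast.fst hbid) hlast.snd measurable_const)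
      · simp only [Fin.snoc_castSucc]
        exact (measurable_pi_apply j).comp hH'
    · simp only [Strategy.history, hist, H']
      rfl

theorem Strategy.exists_measurable_bidAt (π : Strategy S) (t : ℕ) :
    ∃ B : S × (Fin t → ℝ × ℝ) → ℝ, Measurable B ∧
      ∀ ω, π.bidAt t ω = B (ω.1, fun i => ω.2 i) := by
  obtain ⟨H, hH, hist⟩ := π.exists_measurable_history t
  exact ⟨fun p => π.bid t p.1 (H p), (π.measurable_bid t).comp (measurable_fst.prodMk hH),
    fun ω => by rw [Strategy.bidAt, hist]⟩

theorem Strategy.measurable_bidAt (π : Strategy S) (t : ℕ) : Measurable (π.bidAt t) := by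
  obtain ⟨B, hB, h⟩ := π.exists_measurable_bidAt t
  rw [funext h]
  exact hB.comp (by fun_prop)

instance isProbabilityMeasure_outcomeLaw (ν : Measure S) [IsProbabilityMeasure ν] (v : I)
    (μ : ProbabilityMeasure ℝ) : IsProbabilityMeasure (outcomeLaw ν v μ) := by
  unfold outcomeLaw
  infer_instance

theorem outcomeLaw_map_fin (ν : Measure S) [IsProbabilityMeasure ν] (v : I)
    (μ : ProbabilityMeasure ℝ) (t : ℕ) :
    (outcomeLaw ν v μ).map (fun ω => (ω.1, fun i : Fin t => ω.2 i)) =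
      ν.prod (Measure.pi fun _ : Fin t => (μ : Measure ℝ).prod (bernoulliMeasure (1 : ℝ) 0 v)) := by
  rw [outcomeLaw, ← infinitePi_map_fin]
  conv_rhs => rw [← Measure.map_id (μ := ν)]
  rw [Measure.map_prod_map _ _ measurable_id (by fun_prop)]
  rfl

/-- Change of value in an event that depends on the bid of one auction. -/
theorem outcomeLaw_real_bidAt_sq_le (ν : Measure S) [IsProbabilityMeasure ν] (π : Strategy S)
    (μ : ProbabilityMeasure ℝ) (v w : I) (hw : (w : ℝ) ∈ Ioo (0 : ℝ) 1) (t : ℕ) (b : ℝ) :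
    (outcomeLaw ν v μ).real {ω | π.bidAt t ω < b} ^ 2 ≤
      (1 + ((v : ℝ) - w) ^ 2 / (w * (1 - w))) ^ t *
        (outcomeLaw ν w μ).real {ω | π.bidAt t ω < b} := by
  obtain ⟨B, hB, h⟩ := π.exists_measurable_bidAt t
  have hA : MeasurableSet {p | B p < b} := measurableSet_lt hB measurable_const
  have hmap : ∀ u : I, (outcomeLaw ν u μ) {ω | π.bidAt t ω < b} =
      (ν.prod (Measure.pi fun _ : Fin t =>
        (μ : Measure ℝ).prod (bernoulliMeasure (1 : ℝ) 0 u))) {p | B p < b} := by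
    intro u
    rw [← outcomeLaw_map_fin, Measure.map_apply (by fun_prop) hA]
    simp only [h]
    rfl
  -- The randomization and the competing bids have the same law under both values and cost a factor
  -- `1`; only the `t` Bernoulli values count, whether observed or not.
  have hbound := ((SecondMomentBound.refl ν).prod
    (((SecondMomentBound.refl (μ : Measure ℝ)).prod
      (secondMomentBound_bernoulli v w hw)).pi t)).measure_sq_le hA
  rw [← hmap, ← hmap, one_mul, one_mul] at hbound
  have hw0 := hw.1
  have hw1 : 0 < 1 - (w : ℝ) := sub_pos.2 hw.2
  have hC : 0 ≤ 1 + ((v : ℝ) - w) ^ 2 / (w * (1 - w)) := by positivity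
  have hreal := ENNReal.toReal_mono (by finiteness) hbound
  rwa [ENNReal.toReal_pow, ENNReal.toReal_mul, ENNReal.toReal_pow, ENNReal.toReal_ofReal hC]
    at hreal

end History

/-! ### Lower bounds on the regret. -/

section Regret

variable {S : Type*} [MeasurableSpace S] {lam cf Cf : ℝ} {μ : ProbabilityMeasure ℝ}

theorem IsRegularBidLaw.sSup_utility (hμ : IsRegularBidLaw lam cf Cf μ) (v : ℝ) :
    sSup (utility v (cdf (μ : Measure ℝ)) '' Icc 0 1) =
      utility v (cdf (μ : Measure ℝ)) (bestBid v (cdf (μ : Measure ℝ))) := by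
  obtain ⟨hmem, hmax⟩ := hμ.bestBid_mem v
  refine IsGreatest.csSup_eq ⟨mem_image_of_mem _ hmem, ?_⟩
  rintro _ ⟨b, hb, rfl⟩
  exact hmax hb

theorem IsRegularBidLaw.regret_eq_sum (hμ : IsRegularBidLaw lam cf Cf μ) (ν : Measure S)
    (π : Strategy S) (v : I) (T : ℕ) :
    regret ν π v μ T = ∑ t ∈ Finset.range T,
      (utility v (cdf (μ : Measure ℝ)) (bestBid v (cdf (μ : Measure ℝ))) -
        ∫ ω, utility v (cdf (μ : Measure ℝ)) (π.bidAt t ω) ∂(outcomeLaw ν v μ)) := by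
  rw [regret, hμ.sSup_utility, Finset.sum_sub_distrib]
  simp

/-- If all bids from `b` on lose at least `d`, then so does the expected bid, in proportion to the
probability of bidding at least `b`. -/
theorem IsRegularBidLaw.mul_le_round_regret (hμ : IsRegularBidLaw lam cf Cf μ) (ν : Measure S)
    [IsProbabilityMeasure ν] (π : Strategy S) (v : I) (t : ℕ) {b d : ℝ}
    (hd : ∀ x ∈ Icc (0 : ℝ) 1, b ≤ x →
      d ≤ utility v (cdf (μ : Measure ℝ)) (bestBid v (cdf (μ : Measure ℝ))) -
        utility v (cdf (μ : Measure ℝ)) x) :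
    d * (1 - (outcomeLaw ν v μ).real {ω | π.bidAt t ω < b}) ≤
      utility v (cdf (μ : Measure ℝ)) (bestBid v (cdf (μ : Measure ℝ))) -
        ∫ ω, utility v (cdf (μ : Measure ℝ)) (π.bidAt t ω) ∂(outcomeLaw ν v μ) := by
  have hmem : ∀ ω, π.bidAt t ω ∈ Icc (0 : ℝ) 1 := fun ω => π.bid_mem t _ _
  have hmax := (hμ.bestBid_mem v).2
  set u := utility v (cdf (μ : Measure ℝ))
  set β := bestBid v (cdf (μ : Measure ℝ))
  have hu : Continuous u := hμ.continuous_utility v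
  obtain ⟨c, hc⟩ := isCompact_Icc.exists_bound_of_continuousOn (hu.continuousOn (s := Icc 0 1))
  have hint : Integrable (fun ω => u (π.bidAt t ω)) (outcomeLaw ν v μ) :=
    Integrable.of_bound (hu.measurable.comp (π.measurable_bidAt t)).aestronglyMeasurable c
      (ae_of_all _ fun ω => hc _ (hmem ω))
  have hA : MeasurableSet {ω | π.bidAt t ω < b} :=
    measurableSet_lt (π.measurable_bidAt t) measurable_const
  rw [← probReal_compl_eq_one_sub hA]
  calc d * (outcomeLaw ν v μ).real {ω | π.bidAt t ω < b}ᶜ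
      = ∫ ω, {ω | π.bidAt t ω < b}ᶜ.indicator (fun _ => d) ω ∂(outcomeLaw ν v μ) := by
        rw [integral_indicator_const _ hA.compl, smul_eq_mul, mul_comm]
    _ ≤ ∫ ω, (u β - u (π.bidAt t ω)) ∂(outcomeLaw ν v μ) := by
        refine integral_mono ((integrable_const d).indicator hA.compl)
          ((integrable_const _).sub hint) fun ω => ?_
        by_cases hω : π.bidAt t ω < b
        · simpa [indicator, hω] using hmax (hmem ω)
        · simpa [indicator, hω] using hd _ (hmem ω) (not_lt.1 hω)
    _ = u β - ∫ ω, u (π.bidAt t ω) ∂(outcomeLaw ν v μ) := by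
        rw [integral_sub (integrable_const _) hint]
        simp

theorem IsRegularBidLaw.round_regret_nonneg (hμ : IsRegularBidLaw lam cf Cf μ) (ν : Measure S)
    [IsProbabilityMeasure ν] (π : Strategy S) (v : I) (t : ℕ) :
    0 ≤ utility v (cdf (μ : Measure ℝ)) (bestBid v (cdf (μ : Measure ℝ))) -
      ∫ ω, utility v (cdf (μ : Measure ℝ)) (π.bidAt t ω) ∂(outcomeLaw ν v μ) := by
  have h := hμ.mul_le_round_regret ν π v t (b := 0) (d := 0)
    fun x hx _ => sub_nonneg.2 ((hμ.bestBid_mem v).2 hx)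
  rwa [zero_mul] at h

theorem one_add_div_pow_le_exp {K : ℝ} (hK : 0 ≤ K) (t : ℕ) :
    (1 + K / ((t : ℝ) + 1)) ^ t ≤ Real.exp K := by
  have ht : (0 : ℝ) < (t : ℝ) + 1 := by positivity
  calc (1 + K / ((t : ℝ) + 1)) ^ t ≤ Real.exp (K / ((t : ℝ) + 1)) ^ t := by
        gcongr
        linarith [Real.add_one_le_exp (K / ((t : ℝ) + 1))]
    _ = Real.exp (t * (K / ((t : ℝ) + 1))) := by rw [← Real.exp_nat_mul]
    _ ≤ Real.exp K := by
        gcongr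
        rw [mul_div_assoc', div_le_iff₀ ht]
        nlinarith

/-- Rarely bidding below the best bid, uniformly in the value, forces the expected regret of an
auction to be of larger order than `1 / t`. -/
theorem IsRegularBidLaw.eventually_div_le_round_regret (hμ : IsRegularBidLaw lam cf Cf μ)
    (hcf : 0 < cf) (ν : Measure S) [IsProbabilityMeasure ν] (π : Strategy S) {γ : ℝ} (hγ : 0 < γ)
    (hover : ∀ w : I, 0 < cdf (μ : Measure ℝ) (bestBid w (cdf (μ : Measure ℝ))) →
      ∀ t : ℕ, (outcomeLaw ν w μ).real {ω | π.bidAt t ω < bestBid w (cdf (μ : Measure ℝ))}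
        < ((t : ℝ) + 1) ^ (-γ))
    (v : I) (hv : (v : ℝ) ∈ Ioo (0 : ℝ) 1) {K : ℝ} (hK : 0 < K) :
    ∀ᶠ t : ℕ in atTop, K / ((t : ℝ) + 1) ≤
      utility v (cdf (μ : Measure ℝ)) (bestBid v (cdf (μ : Measure ℝ))) -
        ∫ ω, utility v (cdf (μ : Measure ℝ)) (π.bidAt t ω) ∂(outcomeLaw ν v μ) := by
  have hlam := hμ.lam_pos hcf
  obtain ⟨hv0, hv1⟩ := hv
  -- Chosen so that half the quadratic loss at distance `δ / lam`, with `δ ^ 2 = c / (t + 1)`, is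
  -- exactly `K / (t + 1)`.
  set c : ℝ := 4 * lam ^ 2 * K / cf with hc
  have hcpos : 0 < c := by positivity
  set D : ℝ := 2 * c / (v * (1 - v)) with hD
  have hv1' : 0 < 1 - (v : ℝ) := sub_pos.2 hv1
  have hDpos : 0 < D := by positivity
  have htend : Tendsto (fun t : ℕ => (t : ℝ) + 1) atTop atTop :=
    tendsto_atTop_add_const_right _ _ tendsto_natCast_atTop_atTop
  -- This gives `δ < (1 - v) / 2`, which keeps `w < 1` and `w (1 - w) ≥ v (1 - v) / 2`; hence the
  -- factor `2` in `D`.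
  have hsmall : ∀ᶠ t : ℕ in atTop, c / ((t : ℝ) + 1) < ((1 - v) / 2) ^ 2 :=
    (tendsto_const_nhds.div_atTop htend).eventually_lt_const (by positivity)
  have hrare : ∀ᶠ t : ℕ in atTop, Real.exp D * ((t : ℝ) + 1) ^ (-γ) < 1 / 4 := by
    have h := ((tendsto_rpow_neg_atTop hγ).comp htend).const_mul (Real.exp D)
    rw [mul_zero] at h
    exact h.eventually_lt_const (by norm_num)
  filter_upwards [hsmall, hrare] with t hsmall hrare
  have ht : (0 : ℝ) < (t : ℝ) + 1 := by positivity
  set δ : ℝ := √(c / ((t : ℝ) + 1))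
  have hδ : 0 < δ := Real.sqrt_pos.2 (by positivity)
  have hδsq : δ ^ 2 = c / ((t : ℝ) + 1) := Real.sq_sqrt (by positivity)
  have hδlt : δ < (1 - v) / 2 := by
    rw [← hδsq] at hsmall
    exact lt_of_pow_lt_pow_left₀ 2 (by linarith) hsmall
  let w : I := ⟨v + δ, by linarith, by linarith⟩
  have hwv : (w : ℝ) = v + δ := rfl
  have hw : (w : ℝ) ∈ Ioo (0 : ℝ) 1 := ⟨by rw [hwv]; linarith, by rw [hwv]; linarith⟩
  have hbw := hμ.bestBid_mem_Ioo hcf hw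
  have hover' := hover w (hμ.cdf_pos hcf ⟨hbw.1, (hbw.2.trans hw.2).le⟩) t
  obtain ⟨hle, hgrow⟩ := hμ.sub_le_lam_mul_bestBid_sub hcf ⟨hv0, hv1⟩ hw
    (by rw [hwv]; linarith)
  have hchange := outcomeLaw_real_bidAt_sq_le ν π μ v w hw t (bestBid w (cdf (μ : Measure ℝ)))
  set p := (outcomeLaw ν v μ).real {ω | π.bidAt t ω < bestBid w (cdf (μ : Measure ℝ))}
  set Δ := bestBid w (cdf (μ : Measure ℝ)) - bestBid v (cdf (μ : Measure ℝ)) with hΔ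
  have hΔ0 : 0 ≤ Δ := sub_nonneg.2 hle
  have hvar : (v : ℝ) * (1 - v) / 2 ≤ w * (1 - w) := by
    rw [hwv]
    nlinarith
  have hratio : ((v : ℝ) - w) ^ 2 / (w * (1 - w)) ≤ D / ((t : ℝ) + 1) := by
    have hsq : ((v : ℝ) - w) ^ 2 = c / ((t : ℝ) + 1) := by
      rw [hwv, ← hδsq]
      ring
    rw [hsq]
    calc c / ((t : ℝ) + 1) / (w * (1 - w)) ≤ c / ((t : ℝ) + 1) / (v * (1 - v) / 2) := by
          gcongr
      _ = D / ((t : ℝ) + 1) := by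
          rw [hD]
          field_simp
  have hnonneg : 0 ≤ ((v : ℝ) - w) ^ 2 / (w * (1 - w)) :=
    div_nonneg (sq_nonneg _) (mul_nonneg hw.1.le (sub_nonneg.2 hw.2.le))
  have hpsq : p ^ 2 < (1 / 2) ^ 2 := by
    calc p ^ 2 ≤ (1 + ((v : ℝ) - w) ^ 2 / (w * (1 - w))) ^ t *
          (outcomeLaw ν w μ).real {ω | π.bidAt t ω < bestBid w (cdf (μ : Measure ℝ))} := hchange
      _ ≤ Real.exp D * ((t : ℝ) + 1) ^ (-γ) := by
          refine mul_le_mul ?_ hover'.le measureReal_nonneg (Real.exp_pos D).le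
          refine le_trans ?_ (one_add_div_pow_le_exp hDpos.le t)
          gcongr
      _ < (1 / 2) ^ 2 := by linarith
  have hp : p < 1 / 2 := lt_of_pow_lt_pow_left₀ 2 (by norm_num) hpsq
  have hround := hμ.mul_le_round_regret ν π v t (b := bestBid w (cdf (μ : Measure ℝ)))
    (d := cf / 2 * Δ ^ 2) fun x hx hbx => by
      refine le_trans ?_ (hμ.sq_le_utility_sub hcf ⟨hv0, hv1⟩ ⟨hle.trans hbx, hx.2⟩)
      have hsub : Δ ≤ x - bestBid v (cdf (μ : Measure ℝ)) := sub_le_sub_right hbx _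
      gcongr
  refine le_trans ?_ hround
  have hδΔ : δ ≤ lam * Δ := by
    rw [hwv] at hgrow
    linarith
  have hsq : c / ((t : ℝ) + 1) ≤ lam ^ 2 * Δ ^ 2 := by
    rw [← hδsq, ← mul_pow]
    gcongr
  calc K / ((t : ℝ) + 1) = cf / (4 * lam ^ 2) * (c / ((t : ℝ) + 1)) := by
        rw [hc]
        field_simp
    _ ≤ cf / (4 * lam ^ 2) * (lam ^ 2 * Δ ^ 2) := by gcongr
    _ = cf / 2 * Δ ^ 2 * (1 - 1 / 2) := by
        field_simp
        ring
    _ ≤ cf / 2 * Δ ^ 2 * (1 - p) := by gcongr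

/-- The harmonic sum dominates the logarithm; the finitely many uncontrolled terms go into a
constant independent of `T`. -/
theorem exists_mul_log_sub_le_sum {r : ℕ → ℝ} (hr : ∀ t, 0 ≤ r t) {K : ℝ} (hK : 0 ≤ K)
    (h : ∀ᶠ t : ℕ in atTop, K / ((t : ℝ) + 1) ≤ r t) :
    ∃ c, ∀ T : ℕ, K * Real.log T - c ≤ ∑ t ∈ Finset.range T, r t := by
  obtain ⟨N, hN⟩ := eventually_atTop.1 h
  refine ⟨∑ t ∈ Finset.range N, K / ((t : ℝ) + 1), fun T => ?_⟩
  have hlog : K * Real.log T ≤ ∑ t ∈ Finset.range T, K / ((t : ℝ) + 1) := by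
    rcases Nat.eq_zero_or_pos T with rfl | hT
    · simp
    have hharm := log_add_one_le_harmonic T
    rw [harmonic] at hharm
    push_cast at hharm
    have hmono : Real.log T ≤ Real.log ((T : ℝ) + 1) :=
      Real.log_le_log (by exact_mod_cast hT) (by linarith)
    simp only [div_eq_mul_inv, ← Finset.mul_sum]
    exact mul_le_mul_of_nonneg_left (hmono.trans hharm) hK
  have hsplit : ∑ t ∈ Finset.range T, K / ((t : ℝ) + 1) ≤
      ∑ t ∈ Finset.range T, r t + ∑ t ∈ Finset.range N, K / ((t : ℝ) + 1) := by
    calc ∑ t ∈ Finset.range T, K / ((t : ℝ) + 1)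
        ≤ ∑ t ∈ Finset.range T, (r t + if t < N then K / ((t : ℝ) + 1) else 0) := by
          refine Finset.sum_le_sum fun t _ => ?_
          split_ifs with ht
          · linarith [hr t]
          · linarith [hN t (not_lt.1 ht)]
      _ ≤ _ := by
          rw [Finset.sum_add_distrib, ← Finset.sum_filter]
          gcongr
          exact fun t ht => Finset.mem_range.2 (Finset.mem_filter.1 ht).2
  linarith

/-- Under the bound on the probability of bidding below the best bid, for all values at once, the
regret eventually exceeds every multiple of `log T`. (Such strategies exist: upper confidence
bounds at level `1 / t` have regret of order `(log T) ^ 2`.) -/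
theorem IsRegularBidLaw.eventually_le_regret_div_log (hμ : IsRegularBidLaw lam cf Cf μ)
    (hcf : 0 < cf) (ν : Measure S) [IsProbabilityMeasure ν] (π : Strategy S) {γ : ℝ} (hγ : 0 < γ)
    (hover : ∀ w : I, 0 < cdf (μ : Measure ℝ) (bestBid w (cdf (μ : Measure ℝ))) →
      ∀ t : ℕ, (outcomeLaw ν w μ).real {ω | π.bidAt t ω < bestBid w (cdf (μ : Measure ℝ))}
        < ((t : ℝ) + 1) ^ (-γ))
    (v : I) (hv : (v : ℝ) ∈ Ioo (0 : ℝ) 1) {K : ℝ} (hK : 0 ≤ K) :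
    ∀ᶠ T : ℕ in atTop, K ≤ regret ν π v μ T / Real.log T := by
  -- The surplus `log T` from `K + 1` absorbs the constant `c`.
  obtain ⟨c, hc⟩ := exists_mul_log_sub_le_sum (fun t => hμ.round_regret_nonneg ν π v t)
    (K := K + 1) (by linarith)
    (hμ.eventually_div_le_round_regret hcf ν π hγ hover v hv (by linarith))
  have htend : Tendsto (fun T : ℕ => Real.log T) atTop atTop :=
    Real.tendsto_log_atTop.comp tendsto_natCast_atTop_atTop
  filter_upwards [htend.eventually_ge_atTop c, htend.eventually_gt_atTop 0] with T hT hT0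
  rw [le_div_iff₀ hT0, hμ.regret_eq_sum]
  linarith [hc T]

end Regret

end FirstPrice

open FirstPrice in
/-- Known bid distribution: the strategy `π μ` may depend on the law `μ` of the competing bids.
Index `t` stands for the auction number `t + 1`. -/
theorem mainTheorem6 {S : Type*} [MeasurableSpace S] (ν : Measure S) [IsProbabilityMeasure ν]
    (lam cf Cf : ℝ) (hcf : 0 < cf)
    (π : ProbabilityMeasure ℝ → Strategy S)
    (hconsistent : ∀ (μ : ProbabilityMeasure ℝ) (v : I), IsRegularBidLaw lam cf Cf μ →
      0 < cdf (μ : Measure ℝ) (bestBid v (cdf (μ : Measure ℝ))) →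
      ∀ a : ℝ, 0 < a →
        (fun T : ℕ => regret ν (π μ) v μ T) =O[atTop] (fun T : ℕ => (T : ℝ) ^ a))
    (hoverbid : ∀ μ : ProbabilityMeasure ℝ, IsRegularBidLaw lam cf Cf μ →
      ∃ γ : ℝ, 0 < γ ∧ ∀ v : I,
        0 < cdf (μ : Measure ℝ) (bestBid v (cdf (μ : Measure ℝ))) →
        ∀ t : ℕ,
          (outcomeLaw ν v μ).real {ω | (π μ).bidAt t ω < bestBid v (cdf (μ : Measure ℝ))}
            < ((t : ℝ) + 1) ^ (-γ))
    (μ : ProbabilityMeasure ℝ) (v : I) (hμ : IsRegularBidLaw lam cf Cf μ)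
    (hwin : 0 < cdf (μ : Measure ℝ) (bestBid v (cdf (μ : Measure ℝ)))) :
    ((cf ^ 2 * lam ^ 2 *
        ((v : ℝ) * (1 - v) * (v - bestBid v (cdf (μ : Measure ℝ))) / 32) : ℝ) : EReal)
      ≤ liminf (fun T : ℕ => ((regret ν (π μ) v μ T / Real.log T : ℝ) : EReal)) atTop := by
  refine le_liminf_of_le (by isBoundedDefault) ?_
  simp only [EReal.coe_le_coe_iff]
  by_cases hv : (v : ℝ) ∈ Ioo (0 : ℝ) 1
  · obtain ⟨γ, hγ, hover⟩ := hoverbid μ hμ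
    have hbid := (hμ.bestBid_mem_Ioo hcf hv).2
    have hv1 : (0 : ℝ) ≤ 1 - v := sub_nonneg.2 hv.2.le
    have hvb : (0 : ℝ) ≤ v - bestBid v (cdf (μ : Measure ℝ)) := sub_nonneg.2 hbid.le
    have hv0 := hv.1.le
    exact hμ.eventually_le_regret_div_log hcf ν (π μ) hγ hover v hv (by positivity)
  -- A deterministic value makes the bound zero, and the regret is nonnegative.
  · have hdeg : (v : ℝ) * (1 - v) = 0 := by
      rcases v.2.1.eq_or_lt with h0 | h0
      · rw [← h0, zero_mul]
      · rw [le_antisymm v.2.2 (not_lt.1 fun h1 => hv ⟨h0, h1⟩), sub_self, mul_zero]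
    rw [hdeg, zero_mul, zero_div, mul_zero]
    refine Eventually.of_forall fun T => div_nonneg ?_ (Real.log_natCast_nonneg T)
    rw [hμ.regret_eq_sum]
    exact Finset.sum_nonneg fun t _ => hμ.round_regret_nonneg ν (π μ) v t
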